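/- Let $U$ be a real separable Hilbert space, let $\mathbb{T}$ be $[0,\infty)$, $[0,T]$ for some $T\in(0,\infty)$, or $\mathbb{R}$, equipped with Lebesgue measure, and let $(\Omega,\mathcal{F},\mathbb{P})$ be a probability space. For a relatively open set $J\subseteq\mathbb{T}$ and a set $F\subseteq U$, let $C_c^\infty(J;F)$ denote the set of infinitely differentiable functions $\phi\colon\mathbb{T}\to U$ (with one-sided derivatives at endpoints belonging to $\mathbb{T}$) which take values in $F$ and whose support is a compact subset of $J$. Let $\mathcal{L}\colon \mathsf{D}(\mathcal{L})\subseteq L^2(\mathbb{T};U)\to L^2(\mathbb{T};U)$ be a linear operator with bounded inverse $\mathcal{L}^{-1}$ defined on all of $L^2(\mathbb{T};U)$, and put $\mathcal{L}^{-*}:=(\mathcal{L}^{-1})^*$. Let $X=(X(t))_{t\in\mathbb{T}}$ be a $U$-valued Gaussian process on $\Omega$ (all its finite-dimensional distributions are Gaussian) which is mean-square continuous, i.e. $t\mapsto X(t)$ is continuous from $\mathbb{T}$ to $L^2(\Omega;U)$. Suppose that $X$ is coloured by $\mathcal{L}^{-1}$: for every $\phi\in C_c^\infty(\mathbb{T};U)$,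 the real random variable $$\langle X,\phi\rangle_{L^2(\mathbb{T};U)}:=\int_{\mathbb{T}}\langle X(t),\phi(t)\rangle_U\,\mathrm{d}t$$ (the integral being taken in $L^2(\Omega)$) has the same distribution as $\mathscr{W}(\mathcal{L}^{-*}\phi)$, where $(\mathscr{W}(f))_{f\in L^2(\mathbb{T};U)}$ is an isonormal Gaussian process, that is, a family of real, mean-zero Gaussian random variables with $\mathbb{E}[\mathscr{W}(f)\mathscr{W}(g)]=\langle f,g\rangle_{L^2(\mathbb{T};U)}$ for all $f,g\in L^2(\mathbb{T};U)$. Let $F$ be a dense subset of $U$ such that $C_c^\infty(\mathbb{T};F)\subseteq\mathsf{D}(\mathcal{L})$, and suppose that $C_c^\infty(\mathbb{T};F)$ and its image under $\mathcal{L}$ are both dense in $L^2(\mathbb{T};U)$. Suppose that $X$ has the weak Markov property with respect to its natural filtration $\mathcal{F}^X_s:=\sigma(X(t):t\in\mathbb{T},\,t\le s)$: for every $s\in\mathbb{T}$ there exists $\delta>0$ such that, for all $\varepsilon\in(0,\delta)$, the $\sigma$-algebras $\mathcal{F}^X_s$ and $\sigma(X(t):t\in\mathbb{T},\,t\ge s)$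 are conditionally independent given $\sigma(X(u):u\in(s-\varepsilon,s+\varepsilon)\cap\mathbb{T})$. Then the precision operator $\mathcal{L}^*\mathcal{L}$ is local, in the sense that for every (relatively) open interval $J\subseteq\mathbb{T}$, $$\langle\mathcal{L}\phi,\mathcal{L}\psi\rangle_{L^2(\mathbb{T};U)}=0\qquad\text{for all }\phi\in C_c^\infty(J;F),\ \psi\in C_c^\infty(\mathbb{T}\setminus\overline{J};F).$$ -/

import Mathlib

open MeasureTheory ProbabilityTheory Set Filter Topology
open scoped InnerProductSpace

noncomputable section

namespace WeakMarkov

/-- The admissible time sets: the half-line `[0, ∞)`, a compact interval `[0, T]` with `T > 0`,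
or the whole real line. -/
def IsTimeSet (𝕋 : Set ℝ) : Prop :=
  𝕋 = Ici 0 ∨ (∃ T : ℝ, 0 < T ∧ 𝕋 = Icc 0 T) ∨ 𝕋 = univ

/-- Lebesgue measure on `𝕋`. -/
abbrev lebesgue (𝕋 : Set ℝ) : Measure 𝕋 := Measure.comap Subtype.val volume

/-- The real Hilbert space `L²(𝕋; U)` with respect to Lebesgue measure on `𝕋`. -/
abbrev L2 (𝕋 : Set ℝ) (U : Type*) [NormedAddCommGroup U] : Type _ :=
  Lp U 2 (lebesgue 𝕋)

/-- Smoothness of a function on the interval `𝕋` (one-sided derivatives at the endpoints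
which belong to `𝕋`). -/
def IsSmooth {𝕋 : Set ℝ} {U : Type*} [NormedAddCommGroup U] [NormedSpace ℝ U]
    (φ : 𝕋 → U) : Prop :=
  ∃ g : ℝ → U, ContDiffOn ℝ ((⊤ : ℕ∞) : WithTop ℕ∞) g 𝕋 ∧ ∀ t : 𝕋, φ t = g t

/-- `φ ∈ C_c^∞(J; F)`: the function `φ`, defined on `𝕋`, is infinitely differentiable, takes its
values in `F`, and its support is a compact subset of `J`. Functions on `J` are identified
with their extensions by zero to `𝕋`. -/
structure IsTestFunction {𝕋 : Set ℝ} {U : Type*} [NormedAddCommGroup U] [NormedSpace ℝ U]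
    (J : Set 𝕋) (F : Set U) (φ : 𝕋 → U) : Prop where
  smooth : IsSmooth φ
  hasCompactSupport : HasCompactSupport φ
  tsupport_subset : tsupport φ ⊆ J
  mem : ∀ t, φ t ∈ F

/-- `C_c^∞(J; F)` as a subset of `L²(𝕋; U)`. -/
def testSet {𝕋 : Set ℝ} {U : Type*} [NormedAddCommGroup U] [NormedSpace ℝ U]
    (J : Set 𝕋) (F : Set U) : Set (L2 𝕋 U) :=
  {f | ∃ φ : 𝕋 → U, IsTestFunction J F φ ∧ f =ᵐ[lebesgue 𝕋] φ}

theorem testSet_subset_univ {𝕋 : Set ℝ} {U : Type*} [NormedAddCommGroup U] [NormedSpace ℝ U]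
    (J : Set 𝕋) (F : Set U) : testSet J F ⊆ testSet (univ : Set 𝕋) F := by
  rintro f ⟨φ, hφ, hf⟩
  exact ⟨φ, ⟨hφ.smooth, hφ.hasCompactSupport, subset_univ _, hφ.mem⟩, hf⟩

/-- `B` is the bounded inverse of the (possibly unbounded) linear operator `L`. -/
structure IsBoundedInverse {H : Type*} [NormedAddCommGroup H] [NormedSpace ℝ H]
    (L : H →ₗ.[ℝ] H) (B : H →L[ℝ] H) : Prop where
  left_inv : ∀ f : L.domain, B (L f) = f
  right_inv : ∀ g : H, ∃ h : B g ∈ L.domain, L ⟨B g, h⟩ = g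

/-- `W` is an `H`-isonormal Gaussian process: a family of real centred Gaussian random variables
indexed by the Hilbert space `H` with `E[W(f) W(g)] = ⟪f, g⟫`. -/
structure IsIsonormal {H Ω : Type*} [NormedAddCommGroup H] [InnerProductSpace ℝ H]
    [MeasurableSpace Ω] (W : H → Ω → ℝ) (P : Measure Ω) : Prop where
  gaussian : ∀ f, HasGaussianLaw (W f) P
  centered : ∀ f, ∫ ω, W f ω ∂P = 0
  covariance : ∀ f g, ∫ ω, W f ω * W g ω ∂P = ⟪f, g⟫_ℝ

/-- Mean-square continuity of a square-integrable process: `t ↦ X(t)` is continuous from `𝕋`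
into `L²(Ω; U)`. -/
structure IsMeanSquareContinuous {𝕋 : Set ℝ} {U Ω : Type*} [NormedAddCommGroup U]
    [MeasurableSpace Ω] (X : 𝕋 → Ω → U) (P : Measure Ω) : Prop where
  memLp : ∀ t, MemLp (X t) 2 P
  continuous : Continuous fun t => (memLp t).toLp (X t)

/-- The random variable `⟨X, φ⟩_{L²(𝕋; U)} = ∫_𝕋 ⟨X(t), φ(t)⟩_U dt`, as an `L²(Ω)`-valued
Bochner integral over `𝕋`. -/
def pairing {𝕋 : Set ℝ} {U Ω : Type*} [NormedAddCommGroup U] [InnerProductSpace ℝ U]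
    [MeasurableSpace Ω] {X : 𝕋 → Ω → U} {P : Measure Ω}
    (hX : IsMeanSquareContinuous X P) (φ : 𝕋 → U) : Lp ℝ 2 P :=
  ∫ t : 𝕋, ((hX.memLp t).inner_const (φ t)).toLp (fun ω => ⟪X t ω, φ t⟫_ℝ) ∂(lebesgue 𝕋)

/-- The bounded operator `B` on `L²(𝕋; U)` colours the process `X`: for every test function
`φ ∈ C_c^∞(𝕋; U)`, the random variables `⟨X, φ⟩` and `W(B* φ)` have the same distribution,
`W` being an isonormal process. -/
def IsColouredBy {𝕋 : Set ℝ} {U Ω Ω' : Type*} [NormedAddCommGroup U] [InnerProductSpace ℝ U]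
    [CompleteSpace U] [MeasurableSpace Ω] [MeasurableSpace Ω']
    {X : 𝕋 → Ω → U} {P : Measure Ω} (hX : IsMeanSquareContinuous X P)
    (B : L2 𝕋 U →L[ℝ] L2 𝕋 U) (W : L2 𝕋 U → Ω' → ℝ) (P' : Measure Ω') : Prop :=
  ∀ φ : 𝕋 → U, IsTestFunction univ univ φ → ∀ f : L2 𝕋 U, f =ᵐ[lebesgue 𝕋] φ →
    IdentDistrib (pairing hX φ) (W (ContinuousLinearMap.adjoint B f)) P P'

/-- The σ-algebra `σ(X(u) : u ∈ S)`. -/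
@[reducible]
def sigmaOf {𝕋 : Set ℝ} {U Ω : Type*} [MeasurableSpace U] (X : 𝕋 → Ω → U) (S : Set 𝕋) :
    MeasurableSpace Ω :=
  ⨆ u ∈ S, MeasurableSpace.comap (X u) inferInstance

/-- Conditional independence of the σ-algebras `m₁` and `m₂` given the sub-σ-algebra `m'`, on an
arbitrary probability space. -/
def CondIndepGiven {Ω : Type*} [MeasurableSpace Ω] (P : Measure Ω)
    (m' m₁ m₂ : MeasurableSpace Ω) : Prop :=
  ∀ A B : Set Ω, MeasurableSet[m₁] A → MeasurableSet[m₂] B →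
    P⟦A ∩ B | m'⟧ =ᵐ[P] P⟦A | m'⟧ * P⟦B | m'⟧

/-- The weak Markov property with respect to a filtration: `X` is adapted and, for every `s ∈ 𝕋`,
for all sufficiently small `ε > 0` the σ-algebras `ℱ s` and `σ(X(t) : t ≥ s)` are conditionally
independent given `σ(X(u) : u ∈ (s - ε, s + ε) ∩ 𝕋)`. -/
structure IsWeakMarkov {𝕋 : Set ℝ} {U Ω : Type*} [TopologicalSpace U] [MeasurableSpace U]
    {mΩ : MeasurableSpace Ω} (ℱ : Filtration 𝕋 mΩ) (X : 𝕋 → Ω → U) (P : Measure Ω) : Prop where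
  adapted : StronglyAdapted ℱ X
  condIndep : ∀ s : 𝕋, ∃ δ : ℝ, 0 < δ ∧ ∀ ε : ℝ, 0 < ε → ε < δ →
    CondIndepGiven P (sigmaOf X {u : 𝕋 | (u : ℝ) ∈ Ioo ((s : ℝ) - ε) ((s : ℝ) + ε)})
      (ℱ s) (sigmaOf X (Ici s))

end WeakMarkov

end

/-! Write B for `Linv`. Colouring gives `⟨X, f⟩` the second moment `‖B* f‖²`, so `B* f ↦ ⟨X, f⟩`
extends to an isometry V of `L²(𝕋; U)` into the Gaussian Hilbert space of X
(`IsColouredBy.exists_isometry`). For a test function φ in the domain of L, `E[V(Lφ) ⟨X, f⟩] = ⟨Lφ,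
B* f⟩ = ⟨φ, f⟩`, hence `E[V(Lφ) ⟪X(t), x⟫] = ⟪φ(t), x⟫` (`inner_coord_eq`): V(Lφ) is uncorrelated
with X(t) wherever φ vanishes. As `⟨Lφ, Lψ⟩ = E[V(Lφ) V(Lψ)]`, it remains to see that these dual
variables are uncorrelated.

Let the support of φ lie to the left of that of ψ, with a gap around s. For centred Gaussian
variables conditioning is orthogonal projection (`condExp_eq_starProjection`), so the Markov
property says that past and future are orthogonal after subtracting their projections on M, the span
of the values of X in a window inside the gap. Now V(Lφ) is orthogonal to M and to the future, which
forces it into the closed span of the residuals of the past; V(Lψ) is orthogonal to M and to the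
past, hence to those residuals (`inner_eq_zero_of_inner_sub_starProjection`).

For an interval J, a test function supported off the closure of J is the sum of its parts above and
below J, and each part is ordered with respect to J. -/

noncomputable section

namespace WeakMarkov

/-! ### Gaussian laws in `L²(Ω)` -/

section Gaussian

variable {Ω : Type*} {mΩ : MeasurableSpace Ω} {P : Measure Ω}

/-- The constant random variable `1` as an element of `L²(Ω)`. -/
def oneL2 (P : Measure Ω) [IsFiniteMeasure P] : Lp ℝ 2 P :=
  indicatorConstLp 2 MeasurableSet.univ (measure_ne_top P univ) (1 : ℝ)

theorem inner_oneL2 [IsFiniteMeasure P] (ξ : Lp ℝ 2 P) : ⟪oneL2 P, ξ⟫_ℝ = ∫ ω, ξ ω ∂P := by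
  rw [oneL2, L2.inner_indicatorConstLp_one]
  simp

theorem inner_eq_integral_mul (ξ η : Lp ℝ 2 P) : ⟪ξ, η⟫_ℝ = ∫ ω, ξ ω * η ω ∂P := by
  rw [L2.inner_def]
  simp [mul_comm]

theorem norm_exp_mul_I_sub_le (x y : ℝ) :
    ‖Complex.exp (x * Complex.I) - Complex.exp (y * Complex.I)‖ ≤ |x - y| := by
  have h : Complex.exp (x * Complex.I) - Complex.exp (y * Complex.I)
      = Complex.exp (y * Complex.I) * (Complex.exp (Complex.I * ((x - y : ℝ) : ℂ)) - 1) := by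
    rw [mul_sub, ← Complex.exp_add, mul_one]
    congr 2
    push_cast
    ring
  rw [h, norm_mul, Complex.norm_exp_ofReal_mul_I, one_mul]
  exact Real.norm_exp_I_mul_ofReal_sub_one_le

theorem integrable_exp_mul_I [IsFiniteMeasure P] {f : Ω → ℝ} (hf : AEStronglyMeasurable f P) :
    Integrable (fun ω => Complex.exp (f ω * Complex.I)) P := by
  refine Integrable.of_bound (C := 1) ?_ (ae_of_all _ fun ω => ?_)
  · exact (by fun_prop : Continuous fun x : ℝ =>
      Complex.exp (x * Complex.I)).comp_aestronglyMeasurable hf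
  · rw [Complex.norm_exp_ofReal_mul_I]

theorem integral_abs_le_norm [IsProbabilityMeasure P] (ξ : Lp ℝ 2 P) :
    ∫ ω, |ξ ω| ∂P ≤ ‖ξ‖ := by
  have h1 : ∫ ω, ‖ξ ω‖ ∂P = (eLpNorm ξ 1 P).toReal := by
    rw [integral_norm_eq_lintegral_enorm (Lp.aestronglyMeasurable ξ), eLpNorm_one_eq_lintegral_enorm]
  simp only [Real.norm_eq_abs] at h1
  rw [h1, Lp.norm_def]
  exact ENNReal.toReal_mono (Lp.eLpNorm_ne_top ξ)
    (eLpNorm_le_eLpNorm_of_exponent_le (by norm_num) (Lp.aestronglyMeasurable ξ))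

/-- Since `x ↦ exp(ix)` is 1-Lipschitz and the L¹ norm is at most the L² norm, the map is Lipschitz
with constant `|t|`. -/
theorem continuous_integral_exp [IsProbabilityMeasure P] (t : ℝ) :
    Continuous fun ξ : Lp ℝ 2 P => ∫ ω, Complex.exp ((t * ξ ω : ℝ) * Complex.I) ∂P := by
  refine (LipschitzWith.of_dist_le_mul (K := ⟨|t|, abs_nonneg t⟩) fun ξ η => ?_).continuous
  have hm (ξ : Lp ℝ 2 P) : AEStronglyMeasurable (fun ω => t * ξ ω) P :=
    (Lp.aestronglyMeasurable ξ).const_mul t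
  rw [dist_eq_norm, ← integral_sub (integrable_exp_mul_I (hm ξ)) (integrable_exp_mul_I (hm η)),
    dist_eq_norm]
  calc _ ≤ ∫ ω, |t| * |(ξ - η) ω| ∂P := by
        refine norm_integral_le_of_norm_le ?_ ?_
        · exact (((Lp.memLp (ξ - η)).integrable (by norm_num)).abs).const_mul _
        · filter_upwards [Lp.coeFn_sub ξ η] with ω hω
          refine (norm_exp_mul_I_sub_le _ _).trans ?_
          rw [hω, Pi.sub_apply, ← mul_sub, abs_mul]
    _ = |t| * ∫ ω, |(ξ - η) ω| ∂P := integral_const_mul _ _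
    _ ≤ |t| * ‖ξ - η‖ := by gcongr; exact integral_abs_le_norm _

/-- Mean and variance are written as inner products so that both sides are visibly continuous in
`ξ`; Gaussianity thus becomes a closed condition. -/
theorem hasGaussianLaw_iff_integral_exp [IsProbabilityMeasure P] (ξ : Lp ℝ 2 P) :
    HasGaussianLaw ξ P ↔ ∀ t : ℝ, ∫ ω, Complex.exp ((t * ξ ω : ℝ) * Complex.I) ∂P =
      Complex.exp ((t * ⟪oneL2 P, ξ⟫_ℝ : ℝ) * Complex.I -
        ((t ^ 2 * (⟪ξ, ξ⟫_ℝ - ⟪oneL2 P, ξ⟫_ℝ ^ 2) : ℝ) : ℂ) / 2) := by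
  have hξ : AEMeasurable ξ P := (Lp.aestronglyMeasurable ξ).aemeasurable
  rw [hasGaussianLaw_iff_charFun_map_eq hξ]
  refine forall_congr' fun t => ?_
  have h1 : charFun (P.map ξ) t = ∫ ω, Complex.exp ((t * ξ ω : ℝ) * Complex.I) ∂P := by
    rw [charFun_apply_real, integral_map hξ (by fun_prop)]
    simp
  have h2 : ∫ ω, ⟪t, ξ ω⟫_ℝ ∂P = t * ⟪oneL2 P, ξ⟫_ℝ := by
    rw [inner_oneL2, ← integral_const_mul]
    simp [mul_comm]
  have h3 : Var[fun ω => ⟪t, ξ ω⟫_ℝ; P] = t ^ 2 * (⟪ξ, ξ⟫_ℝ - ⟪oneL2 P, ξ⟫_ℝ ^ 2) := by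
    have : (fun ω => ⟪t, ξ ω⟫_ℝ) = fun ω => t * ξ ω := by ext; simp [mul_comm]
    rw [this, variance_const_mul, variance_eq_sub (Lp.memLp ξ), inner_oneL2, inner_eq_integral_mul]
    simp [pow_two]
  rw [h1, h2, h3]

theorem isClosed_setOf_hasGaussianLaw [IsProbabilityMeasure P] :
    IsClosed {ξ : Lp ℝ 2 P | HasGaussianLaw ξ P} := by
  simp only [hasGaussianLaw_iff_integral_exp, Set.ofPred_forall]
  refine isClosed_iInter fun t => isClosed_eq (continuous_integral_exp t) ?_
  fun_prop

/-- A linear functional of finitely many `Y i` is again an element of `G`, so one-dimensional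
Gaussianity on a subspace already gives joint Gaussianity. -/
theorem isGaussianProcess_of_mem [IsProbabilityMeasure P] {G : Submodule ℝ (Lp ℝ 2 P)}
    (hG : ∀ ξ ∈ G, HasGaussianLaw ξ P) {ι : Type*} (Y : ι → Lp ℝ 2 P) (hY : ∀ i, Y i ∈ G) :
    IsGaussianProcess (fun i ω => Y i ω) P where
  hasGaussianLaw I := by
    have hm : AEMeasurable (fun ω => I.restrict (fun i => Y i ω)) P :=
      aemeasurable_pi_iff.2 fun i => (Lp.aestronglyMeasurable (Y i)).aemeasurable
    refine ⟨⟨fun L => ?_⟩⟩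
    have hL : HasGaussianLaw (fun ω => L (I.restrict (fun i => Y i ω))) P := by
      classical
      have hmem : ∑ i : I, L (Pi.single i 1) • Y i ∈ G :=
        G.sum_mem fun i _ => G.smul_mem _ (hY i)
      refine (hG _ hmem).congr ?_
      have h1 := Lp.coeFn_finsetSum (p := 2) (μ := P) Finset.univ
        (fun i : I => L (Pi.single i 1) • Y i)
      have h2 : ∀ᵐ ω ∂P, ∀ i : I, (L (Pi.single i 1) • Y i : Lp ℝ 2 P) ω
          = L (Pi.single i 1) * Y i ω := by
        rw [ae_all_iff]
        intro i
        filter_upwards [Lp.coeFn_smul (L (Pi.single i 1)) (Y i)] with ω hω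
        simpa using hω
      filter_upwards [h1, h2] with ω h1 h2
      rw [h1, Finset.sum_apply, ← L.sum_comp_single]
      refine Finset.sum_congr rfl fun i _ => ?_
      rw [h2 i]
      have : (Pi.single i (I.restrict (fun i => Y i ω) i) : I → ℝ)
          = (Y i ω) • (Pi.single i (1 : ℝ) : I → ℝ) := by
        ext j
        by_cases h : j = i <;> simp [h, Pi.single_apply]
      simp only [ContinuousLinearMap.comp_apply, ContinuousLinearMap.single_apply]
      rw [this, map_smul, smul_eq_mul, mul_comm]
    have h := hL.map_eq_gaussianReal
    rw [AEMeasurable.map_map_of_aemeasurable (by fun_prop) hm, integral_map hm (by fun_prop),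
      variance_map (by fun_prop) hm]
    exact h

end Gaussian

/-! ### The Hilbert space form of the Markov argument -/

section Hilbert

variable {K : Type*} [NormedAddCommGroup K] [InnerProductSpace ℝ K] [CompleteSpace K]

/-- Two vectors of the closed span of `s ∪ u` are orthogonal as soon as one is orthogonal to `u`
and the other to `s`, both are orthogonal to `M`, and the parts of `s` and `u` orthogonal to `M`
are orthogonal to each other. -/
theorem inner_eq_zero_of_inner_sub_starProjection {M : Submodule ℝ K} [M.HasOrthogonalProjection]
    {s u : Set K} (hsu : ∀ a ∈ s, ∀ c ∈ u, ⟪a - M.starProjection a, c - M.starProjection c⟫_ℝ = 0)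
    {x y : K} (hx : x ∈ (Submodule.span ℝ (s ∪ u)).topologicalClosure)
    (hxM : x ∈ Mᗮ) (hyM : y ∈ Mᗮ) (hxu : ∀ c ∈ u, ⟪c, x⟫_ℝ = 0) (hys : ∀ a ∈ s, ⟪a, y⟫_ℝ = 0) :
    ⟪x, y⟫_ℝ = 0 := by
  -- `A` is the closed span of the residuals of `s`. It contains `x`, and `y` is orthogonal to it.
  set A := (Submodule.span ℝ ((fun a => a - M.starProjection a) '' s)).topologicalClosure with hA
  have hAc : IsClosed (A : Set K) := Submodule.isClosed_topologicalClosure _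
  have : CompleteSpace A := hAc.completeSpace_coe
  have horth : ∀ (B : Set K) (z : K), (∀ b ∈ B, ⟪b, z⟫_ℝ = 0) →
      ∀ b ∈ (Submodule.span ℝ B).topologicalClosure, ⟪b, z⟫_ℝ = 0 := by
    intro B z hz b hb
    have h1 : Submodule.span ℝ B ≤ (Submodule.span ℝ {z})ᗮ := by
      refine Submodule.span_le.2 fun b hb => ?_
      rw [SetLike.mem_coe, Submodule.mem_orthogonal_singleton_iff_inner_left]
      exact hz b hb
    have h2 := Submodule.topologicalClosure_minimal _ h1 (Submodule.isClosed_orthogonal _) hb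
    exact Submodule.mem_orthogonal_singleton_iff_inner_left.1 h2
  have hM : ∀ z ∈ Mᗮ, ∀ w, ⟪w - M.starProjection w, z⟫_ℝ = ⟪w, z⟫_ℝ := by
    intro z hz w
    rw [inner_sub_left, hz _ (M.starProjection_apply_mem w), sub_zero]
  have hsub : ∀ w, w - M.starProjection w ∈ Mᗮ := fun w => M.sub_starProjection_mem_orthogonal w
  have hAM : A ≤ Mᗮ := by
    refine Submodule.topologicalClosure_minimal _ (Submodule.span_le.2 ?_)
      (Submodule.isClosed_orthogonal _)
    rintro _ ⟨a, -, rfl⟩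
    exact hsub a
  have hxA : x ∈ A := by
    set r := x - A.starProjection x with hr
    have hrA : r ∈ Aᗮ := A.sub_starProjection_mem_orthogonal x
    have hrM : r ∈ Mᗮ := Mᗮ.sub_mem hxM (hAM (A.starProjection_apply_mem x))
    -- On `s`, `r ⊥ M` lets `b` be replaced by its residual, which lies in `A`. On `u`, both `x` and
    -- its projection on `A` are orthogonal to `b`. So `r` is orthogonal to `x` and to `A`, hence to
    -- itself.
    have h0 : ∀ b ∈ s ∪ u, ⟪b, r⟫_ℝ = 0 := by
      rintro b (hb | hb)
      · rw [← hM r hrM]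
        exact hrA _ (Submodule.le_topologicalClosure _ (Submodule.subset_span ⟨b, hb, rfl⟩))
      · rw [hr, inner_sub_right, hxu b hb, zero_sub, neg_eq_zero,
          ← hM _ (hAM (A.starProjection_apply_mem x)), real_inner_comm]
        refine horth _ _ ?_ _ (A.starProjection_apply_mem x)
        rintro _ ⟨a, ha, rfl⟩
        exact hsu a ha b hb
    have h1 : ⟪x, r⟫_ℝ = 0 := horth _ _ h0 x hx
    have h2 : ⟪A.starProjection x, r⟫_ℝ = 0 := hrA _ (A.starProjection_apply_mem x)
    have h3 : ⟪r, r⟫_ℝ = 0 := by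
      conv_lhs => rw [hr]
      rw [inner_sub_left, h1, h2, sub_zero]
    have h4 : x = A.starProjection x := sub_eq_zero.1 (inner_self_eq_zero.1 h3)
    rw [h4]
    exact A.starProjection_apply_mem x
  refine horth _ _ ?_ x hxA
  rintro _ ⟨a, ha, rfl⟩
  rw [hM y hyM, hys a ha]

end Hilbert

/-! ### Conditional independence for square-integrable variables -/

section CondExp

variable {Ω : Type*} {m m' m₁ m₂ mΩ : MeasurableSpace Ω} {P : Measure Ω}
  [IsProbabilityMeasure P]

theorem integral_mul_condExp_left (hm : m ≤ mΩ) {f g : Ω → ℝ}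
    (hf : MemLp f 2 P) (hg : MemLp g 2 P) :
    ∫ ω, (P[f|m]) ω * g ω ∂P = ∫ ω, (P[f|m]) ω * (P[g|m]) ω ∂P := by
  have hcf : MemLp (P[f|m]) 2 P := hf.condExp (by norm_num)
  have h := condExp_mul_of_stronglyMeasurable_left (μ := P) (m := m) (f := P[f|m]) (g := g)
    stronglyMeasurable_condExp (hcf.integrable_mul hg) (hg.integrable (by norm_num))
  rw [← integral_condExp hm (f := fun ω => (P[f|m]) ω * g ω)]
  exact integral_congr_ae h

theorem integral_mul_condExp_right (hm : m ≤ mΩ) {f g : Ω → ℝ}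
    (hf : MemLp f 2 P) (hg : MemLp g 2 P) :
    ∫ ω, f ω * (P[g|m]) ω ∂P = ∫ ω, (P[f|m]) ω * (P[g|m]) ω ∂P := by
  simpa only [mul_comm] using integral_mul_condExp_left hm hg hf

theorem integral_mul_eq_zero_of_setIntegral_eq_zero (hm : m ≤ mΩ)
    {f h : Ω → ℝ} (hf : MemLp f 2 P) (hfm : StronglyMeasurable[m] f) (hh : MemLp h 2 P)
    (h0 : ∀ A, MeasurableSet[m] A → ∫ ω in A, h ω ∂P = 0) : ∫ ω, f ω * h ω ∂P = 0 := by
  have h1 : P[h|m] =ᵐ[P] 0 := by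
    symm
    refine ae_eq_condExp_of_forall_setIntegral_eq hm (hh.integrable (by norm_num)) ?_ ?_ ?_
    · intro s _ _
      exact (integrable_zero _ _ _).integrableOn
    · intro s hs _
      simp [h0 s hs]
    · exact stronglyMeasurable_zero.aestronglyMeasurable
  have h2 := condExp_mul_of_stronglyMeasurable_left (μ := P) (m := m) (f := f) (g := h)
    hfm (hf.integrable_mul hh) (hh.integrable (by norm_num))
  rw [← integral_condExp hm (f := fun ω => f ω * h ω)]
  refine (integral_congr_ae (h2.trans (h1.mono fun ω hω => ?_))).trans (integral_zero Ω ℝ)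
  simp [hω]

/-- The definition gives this for indicators. An identity `E[f (l - E[l|m'])] = 0` passes from
indicators to square-integrable functions in the first factor; doing this once for each factor gives
the general case. -/
theorem CondIndepGiven.integral_mul
    (h : CondIndepGiven P m' m₁ m₂) (hm' : m' ≤ mΩ) (hm₁ : m₁ ≤ mΩ) (hm₂ : m₂ ≤ mΩ)
    {f g : Ω → ℝ} (hf : MemLp f 2 P) (hfm : StronglyMeasurable[m₁] f)
    (hg : MemLp g 2 P) (hgm : StronglyMeasurable[m₂] g) :
    ∫ ω, f ω * g ω ∂P = ∫ ω, (P[f|m']) ω * (P[g|m']) ω ∂P := by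
  have hind (B : Set Ω) (hB : MeasurableSet B) : MemLp (B.indicator fun _ => (1 : ℝ)) 2 P :=
    (memLp_const 1).indicator hB
  have hsub {k : Ω → ℝ} (hk : MemLp k 2 P) : MemLp (k - P[k|m']) 2 P :=
    hk.sub (hk.condExp (by norm_num))
  have hdiff {k l : Ω → ℝ} (hk : MemLp k 2 P) (hl : MemLp l 2 P) :
      ∫ ω, k ω * (l - P[l|m']) ω ∂P
        = ∫ ω, k ω * l ω ∂P - ∫ ω, (P[k|m']) ω * (P[l|m']) ω ∂P := by
    rw [← integral_mul_condExp_right hm' hk hl]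
    refine Eq.trans ?_ (integral_sub (hk.integrable_mul hl)
      (hk.integrable_mul (hl.condExp (by norm_num))))
    simp [mul_sub]
  have hset (A : Set Ω) (hA : MeasurableSet A) (k : Ω → ℝ) :
      ∫ ω in A, k ω ∂P = ∫ ω, A.indicator (fun _ => (1 : ℝ)) ω * k ω ∂P := by
    rw [← integral_indicator hA]
    congr with ω
    by_cases hω : ω ∈ A <;> simp [hω]
  have hAB (A B : Set Ω) (hA : MeasurableSet[m₁] A) (hB : MeasurableSet[m₂] B) :
      ∫ ω, A.indicator (fun _ => (1 : ℝ)) ω * B.indicator (fun _ => (1 : ℝ)) ω ∂P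
        = ∫ ω, (P⟦A|m'⟧) ω * (P⟦B|m'⟧) ω ∂P := by
    refine Eq.trans ?_ ((integral_condExp hm').symm.trans (integral_congr_ae (h A B hA hB)))
    congr with ω
    by_cases h₁ : ω ∈ A <;> by_cases h₂ : ω ∈ B <;> simp [h₁, h₂]
  have hfB (B : Set Ω) (hB : MeasurableSet[m₂] B) :
      ∫ ω, f ω * (B.indicator (fun _ => (1 : ℝ)) - P⟦B|m'⟧) ω ∂P = 0 := by
    refine integral_mul_eq_zero_of_setIntegral_eq_zero hm₁ hf hfm (hsub (hind B (hm₂ B hB))) ?_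
    intro A hA
    rw [hset A (hm₁ A hA), hdiff (hind A (hm₁ A hA)) (hind B (hm₂ B hB)), hAB A B hA hB, sub_self]
  have hgf : ∫ ω, g ω * (f - P[f|m']) ω ∂P = 0 := by
    refine integral_mul_eq_zero_of_setIntegral_eq_zero hm₂ hg hgm (hsub hf) ?_
    intro B hB
    have := hfB B hB
    rw [hdiff hf (hind B (hm₂ B hB))] at this
    rw [hset B (hm₂ B hB), hdiff (hind B (hm₂ B hB)) hf]
    simpa only [mul_comm] using this
  rw [hdiff hg hf, sub_eq_zero] at hgf
  simpa only [mul_comm] using hgf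

end CondExp

/-! ### The Gaussian Hilbert space of the process, and conditioning as projection -/

section GaussianHilbertSpace

variable {𝕋 : Set ℝ} {U : Type*} [NormedAddCommGroup U] [InnerProductSpace ℝ U]
  {Ω : Type*} {mΩ : MeasurableSpace Ω} {P : Measure Ω} {X : 𝕋 → Ω → U}

/-- The random variable `⟪X(t), x⟫` as an element of `L²(Ω)`. -/
def coord (hX : IsMeanSquareContinuous X P) (t : 𝕋) (x : U) : Lp ℝ 2 P :=
  ((hX.memLp t).inner_const x).toLp (fun ω => ⟪X t ω, x⟫_ℝ)

theorem coeFn_coord (hX : IsMeanSquareContinuous X P) (t : 𝕋) (x : U) :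
    coord hX t x =ᵐ[P] fun ω => ⟪X t ω, x⟫_ℝ :=
  MemLp.coeFn_toLp _

/-- The random variables `⟪X(t), x⟫` with `t ∈ S`. -/
def coordSet (hX : IsMeanSquareContinuous X P) (S : Set 𝕋) : Set (Lp ℝ 2 P) :=
  {ξ | ∃ t ∈ S, ∃ x, ξ = coord hX t x}

/-- The Gaussian Hilbert space of `X` restricted to the times in `S`. -/
def gaussianSpan (hX : IsMeanSquareContinuous X P) (S : Set 𝕋) : Submodule ℝ (Lp ℝ 2 P) :=
  (Submodule.span ℝ (coordSet hX S)).topologicalClosure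

theorem coord_mem_gaussianSpan (hX : IsMeanSquareContinuous X P) {S : Set 𝕋} {t : 𝕋} (ht : t ∈ S)
    (x : U) : coord hX t x ∈ gaussianSpan hX S :=
  Submodule.le_topologicalClosure _ (Submodule.subset_span ⟨t, ht, x, rfl⟩)

theorem gaussianSpan_mono (hX : IsMeanSquareContinuous X P) {S S' : Set 𝕋} (h : S ⊆ S') :
    gaussianSpan hX S ≤ gaussianSpan hX S' :=
  Submodule.topologicalClosure_mono (Submodule.span_mono
    fun _ ⟨t, ht, x, hξ⟩ => ⟨t, h ht, x, hξ⟩)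

instance (hX : IsMeanSquareContinuous X P) (S : Set 𝕋) : CompleteSpace (gaussianSpan hX S) :=
  (Submodule.isClosed_topologicalClosure _).completeSpace_coe

theorem gaussianSpan_le (hX : IsMeanSquareContinuous X P) {S : Set 𝕋}
    {G : Submodule ℝ (Lp ℝ 2 P)} (hG : IsClosed (G : Set (Lp ℝ 2 P)))
    (h : ∀ t ∈ S, ∀ x, coord hX t x ∈ G) : gaussianSpan hX S ≤ G := by
  refine Submodule.topologicalClosure_minimal _ (Submodule.span_le.2 ?_) hG
  rintro _ ⟨t, ht, x, rfl⟩
  exact h t ht x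

theorem mem_orthogonal_gaussianSpan (hX : IsMeanSquareContinuous X P) {S : Set 𝕋}
    {ξ : Lp ℝ 2 P} (h : ∀ t ∈ S, ∀ x, ⟪coord hX t x, ξ⟫_ℝ = 0) : ξ ∈ (gaussianSpan hX S)ᗮ := by
  have h1 : gaussianSpan hX S ≤ (Submodule.span ℝ {ξ})ᗮ :=
    gaussianSpan_le hX (Submodule.isClosed_orthogonal _) fun t ht x =>
      Submodule.mem_orthogonal_singleton_iff_inner_left.2 (h t ht x)
  intro η hη
  exact Submodule.mem_orthogonal_singleton_iff_inner_left.1 (h1 hη)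

section Measurability

variable [CompleteSpace U] [SecondCountableTopology U] [MeasurableSpace U] [BorelSpace U]

/-- Inner products with a dense sequence map the Polish space `U` injectively and measurably into `ℕ
→ ℝ`; by Lusin–Souslin this is a measurable embedding. -/
theorem measurable_of_forall_inner {α : Type*} {m : MeasurableSpace α} {f : α → U}
    (h : ∀ x, Measurable fun a => ⟪f a, x⟫_ℝ) : Measurable f := by
  have : PolishSpace U := inferInstance
  let ι : U → ℕ → ℝ := fun y n => ⟪y, TopologicalSpace.denseSeq U n⟫_ℝ
  have hι : MeasurableEmbedding ι := by
    refine Measurable.measurableEmbedding (by fun_prop) fun y z hyz => ?_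
    rw [← sub_eq_zero, ← inner_self_eq_zero (𝕜 := ℝ)]
    refine (TopologicalSpace.denseRange_denseSeq U).induction_on (p := fun x => ⟪y - z, x⟫_ℝ = 0)
      (y - z) (isClosed_eq (by fun_prop) continuous_const) fun n => ?_
    rw [inner_sub_left, sub_eq_zero]
    exact congrFun hyz n
  rw [← hι.measurable_comp_iff]
  exact measurable_pi_lambda _ fun n => h _

omit [NormedAddCommGroup U] [InnerProductSpace ℝ U] [CompleteSpace U] [SecondCountableTopology U]
  [BorelSpace U] in
theorem sigmaOf_le (hX : ∀ t, Measurable (X t)) (S : Set 𝕋) : sigmaOf X S ≤ mΩ :=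
  iSup₂_le fun t _ => (hX t).comap_le

omit [NormedAddCommGroup U] [InnerProductSpace ℝ U] [CompleteSpace U] [SecondCountableTopology U]
  [BorelSpace U] in
theorem measurable_sigmaOf {S : Set 𝕋} {t : 𝕋} (ht : t ∈ S) : Measurable[sigmaOf X S] (X t) :=
  (comap_measurable (X t)).mono (le_iSup₂_of_le (f := fun t (_ : t ∈ S) =>
    MeasurableSpace.comap (X t) inferInstance) t ht le_rfl) le_rfl

omit [CompleteSpace U] in
theorem stronglyMeasurable_inner_sigmaOf {S : Set 𝕋} {t : 𝕋} (ht : t ∈ S) (x : U) :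
    StronglyMeasurable[sigmaOf X S] fun ω => ⟪X t ω, x⟫_ℝ := by
  have h : Measurable[sigmaOf X S] fun ω => ⟪X t ω, x⟫_ℝ :=
    (by fun_prop : Measurable fun y : U => ⟪y, x⟫_ℝ).comp (measurable_sigmaOf ht)
  exact h.stronglyMeasurable

theorem sigmaOf_le_comap_inner (S : Set 𝕋) :
    sigmaOf X S ≤ MeasurableSpace.comap (fun ω (p : S × U) => ⟪X p.1 ω, p.2⟫_ℝ) inferInstance := by
  refine iSup₂_le fun t ht => ?_
  rw [← measurable_iff_comap_le]
  refine measurable_of_forall_inner fun x => ?_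
  exact (measurable_pi_apply (X := fun _ : S × U => ℝ) (⟨⟨t, ht⟩, x⟩ : S × U)).comp
    (comap_measurable _)

end Measurability

/-- Finite combinations are continuous linear images of finite-dimensional distributions of `X`;
their limits stay Gaussian because Gaussianity is closed in `L²`. -/
theorem hasGaussianLaw_of_mem_gaussianSpan [CompleteSpace U] [SecondCountableTopology U]
    [MeasurableSpace U] [BorelSpace U] [IsProbabilityMeasure P]
    (hX : IsMeanSquareContinuous X P) (hg : IsGaussianProcess X P) {S : Set 𝕋} {ξ : Lp ℝ 2 P}
    (hξ : ξ ∈ gaussianSpan hX S) : HasGaussianLaw ξ P := by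
  have hspan : (Submodule.span ℝ (coordSet hX S) : Set (Lp ℝ 2 P)) ⊆
      {ξ | HasGaussianLaw ξ P} := by
    intro ξ hξ
    obtain ⟨n, c, g, rfl⟩ := Submodule.mem_span_set'.1 hξ
    choose t ht x hx using fun i => (g i).2
    let L : (Finset.univ.image t → U) →L[ℝ] ℝ :=
      ∑ i, c i • (innerSL ℝ (x i)) ∘L
        (ContinuousLinearMap.proj (⟨t i, by simp⟩ : Finset.univ.image t))
    have h1 := (hg.hasGaussianLaw (Finset.univ.image t)).map_fun L
    refine h1.congr ?_
    have h2 := Lp.coeFn_finsetSum (p := 2) (μ := P) Finset.univ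
      (fun i => c i • (g i : Lp ℝ 2 P))
    have h3 : ∀ᵐ ω ∂P, ∀ i, (c i • (g i : Lp ℝ 2 P) : Lp ℝ 2 P) ω = c i * ⟪X (t i) ω, x i⟫_ℝ := by
      rw [ae_all_iff]
      intro i
      filter_upwards [Lp.coeFn_smul (c i) (g i : Lp ℝ 2 P), coeFn_coord hX (t i) (x i)]
        with ω hω hω'
      rw [hω, Pi.smul_apply, hx i, hω', smul_eq_mul]
    filter_upwards [h2, h3] with ω h2 h3
    rw [h2, Finset.sum_apply]
    simp only [h3]
    simp [L, real_inner_comm]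
  exact closure_minimal hspan isClosed_setOf_hasGaussianLaw hξ

variable [CompleteSpace U] [SecondCountableTopology U] [MeasurableSpace U] [BorelSpace U]
  [IsProbabilityMeasure P]

/-- Orthogonality of centred variables is zero covariance, which under joint Gaussianity is
independence; the conditional expectation is then the mean, namely 0. -/
theorem condExp_eq_zero_of_mem_orthogonal (hX : IsMeanSquareContinuous X P)
    (hg : IsGaussianProcess X P) (hm : ∀ t, Measurable (X t))
    (h0 : ∀ t x, ⟪oneL2 P, coord hX t x⟫_ℝ = 0) {S : Set 𝕋} {η : Lp ℝ 2 P}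
    (hη : η ∈ gaussianSpan hX univ) (hηS : η ∈ (gaussianSpan hX S)ᗮ) :
    P[η | sigmaOf X S] =ᵐ[P] 0 := by
  have hη0 : ∫ ω, η ω ∂P = 0 := by
    rw [← inner_oneL2, real_inner_comm]
    refine (mem_orthogonal_gaussianSpan hX (S := univ) (ξ := oneL2 P) fun t _ x => ?_) η hη
    rw [real_inner_comm, h0]
  let Y : S × U → Ω → ℝ := fun p ω => ⟪X p.1 ω, p.2⟫_ℝ
  have hproc : IsGaussianProcess (Sum.elim (fun (_ : Unit) => (η : Ω → ℝ)) Y) P := by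
    have h := isGaussianProcess_of_mem (P := P) (G := gaussianSpan hX univ)
      (fun ξ hξ => hasGaussianLaw_of_mem_gaussianSpan hX hg hξ)
      (Sum.elim (fun (_ : Unit) => η) (fun p : S × U => coord hX p.1 p.2)) (by
        rintro (i | p)
        · exact hη
        · exact coord_mem_gaussianSpan hX (mem_univ _) _)
    refine h.congr ?_
    rintro (i | p)
    · exact ae_eq_rfl
    · exact coeFn_coord hX _ _
  have hYm (p : S × U) : Measurable (Y p) :=
    (by fun_prop : Measurable fun y : U => ⟪y, p.2⟫_ℝ).comp (hm p.1)
  have hind := hproc.indepFun_of_covariance_eq_zero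
    (fun _ => (Lp.stronglyMeasurable η).measurable.aemeasurable)
    (fun p => (hYm p).aemeasurable) (by
      intro _ p
      rw [covariance_eq_sub (Lp.memLp η) ((hX.memLp p.1).inner_const p.2), hη0, zero_mul, sub_zero]
      have := hηS _ (coord_mem_gaussianSpan hX p.1.2 p.2)
      rw [real_inner_comm, inner_eq_integral_mul] at this
      rw [← this]
      refine integral_congr_ae ?_
      filter_upwards [coeFn_coord hX p.1 p.2] with ω hω
      rw [hω]
      rfl)
  have hle : MeasurableSpace.comap (fun ω (p : S × U) => Y p ω) inferInstance ≤ mΩ :=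
    (measurable_pi_lambda _ hYm).comap_le
  have hmeas : Measurable[MeasurableSpace.comap (fun ω (_ : Unit) => η ω) inferInstance] η :=
    (measurable_pi_apply ()).comp (comap_measurable (fun ω (_ : Unit) => η ω))
  have h1 := condExp_indep_eq (μ := P) (f := η)
    (measurable_pi_lambda (fun ω (_ : Unit) => η ω)
      fun _ => (Lp.stronglyMeasurable η).measurable).comap_le
    (sigmaOf_le hm S) hmeas.stronglyMeasurable
    (indep_of_indep_of_le_right hind (sigmaOf_le_comap_inner S))
  rw [hη0] at h1
  exact h1

-- The `L²` classes measurable with respect to `sigmaOf X S` form a closed subspace containing the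
-- generators.
omit [CompleteSpace U] [IsProbabilityMeasure P] in
theorem aestronglyMeasurable_of_mem_gaussianSpan (hX : IsMeanSquareContinuous X P)
    (hm : ∀ t, Measurable (X t)) {S : Set 𝕋} {η : Lp ℝ 2 P} (hη : η ∈ gaussianSpan hX S) :
    AEStronglyMeasurable[sigmaOf X S] η P := by
  have h : gaussianSpan hX S ≤ lpMeas ℝ ℝ (sigmaOf X S) 2 P := by
    refine gaussianSpan_le hX (isClosed_aestronglyMeasurable (sigmaOf_le hm S)) fun t ht x => ?_
    rw [mem_lpMeas_iff_aestronglyMeasurable]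
    exact ⟨_, stronglyMeasurable_inner_sigmaOf ht x, coeFn_coord hX t x⟩
  exact mem_lpMeas_iff_aestronglyMeasurable.1 (h hη)

/-- On the Gaussian Hilbert space of a centred Gaussian process, conditioning on
`σ(X(u) : u ∈ S)` is the orthogonal projection. -/
theorem condExp_eq_starProjection (hX : IsMeanSquareContinuous X P)
    (hg : IsGaussianProcess X P) (hm : ∀ t, Measurable (X t))
    (h0 : ∀ t x, ⟪oneL2 P, coord hX t x⟫_ℝ = 0) {S : Set 𝕋} {η : Lp ℝ 2 P}
    (hη : η ∈ gaussianSpan hX univ) :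
    P[η | sigmaOf X S] =ᵐ[P] (gaussianSpan hX S).starProjection η := by
  set Q := (gaussianSpan hX S).starProjection η with hQ
  have hQm : Q ∈ gaussianSpan hX S := (gaussianSpan hX S).starProjection_apply_mem η
  have h1 := condExp_eq_zero_of_mem_orthogonal hX hg hm h0 (S := S) (η := η - Q)
    (Submodule.sub_mem _ hη (gaussianSpan_mono hX (subset_univ S) hQm))
    ((gaussianSpan hX S).sub_starProjection_mem_orthogonal η)
  have hi (ξ : Lp ℝ 2 P) : Integrable ξ P := (Lp.memLp ξ).integrable (by norm_num)
  have h2 : P[η | sigmaOf X S] =ᵐ[P] P[(η - Q : Lp ℝ 2 P) | sigmaOf X S] + P[Q | sigmaOf X S] := by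
    refine (condExp_congr_ae ?_).trans (condExp_add (hi _) (hi _) _)
    filter_upwards [Lp.coeFn_sub η Q] with ω hω
    rw [Pi.add_apply, hω, Pi.sub_apply, sub_add_cancel]
  have h3 := condExp_of_aestronglyMeasurable' (sigmaOf_le hm S)
    (aestronglyMeasurable_of_mem_gaussianSpan hX hm hQm) (hi Q)
  filter_upwards [h1, h2, h3] with ω h1 h2 h3
  rw [h2, Pi.add_apply, h1, h3]
  simp

/-- The form in which the Markov property is used: the inner product of two coordinates equals that
of their projections, so the residuals are orthogonal. -/
theorem inner_sub_starProjection_eq_zero (hX : IsMeanSquareContinuous X P)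
    (hg : IsGaussianProcess X P) (hm : ∀ t, Measurable (X t))
    (h0 : ∀ t x, ⟪oneL2 P, coord hX t x⟫_ℝ = 0) {S S₁ S₂ : Set 𝕋}
    (hS : CondIndepGiven P (sigmaOf X S) (sigmaOf X S₁) (sigmaOf X S₂)) :
    ∀ a ∈ coordSet hX S₁, ∀ c ∈ coordSet hX S₂,
      ⟪a - (gaussianSpan hX S).starProjection a, c - (gaussianSpan hX S).starProjection c⟫_ℝ = 0 := by
  rintro _ ⟨t, ht, x, rfl⟩ _ ⟨t', ht', x', rfl⟩
  set Q := (gaussianSpan hX S).starProjection with hQ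
  have h1 : ⟪Q (coord hX t x), coord hX t' x' - Q (coord hX t' x')⟫_ℝ = 0 :=
    (gaussianSpan hX S).sub_starProjection_mem_orthogonal _ _
      ((gaussianSpan hX S).starProjection_apply_mem _)
  have h2 : ⟪coord hX t x - Q (coord hX t x), Q (coord hX t' x')⟫_ℝ = 0 := by
    rw [real_inner_comm]
    exact (gaussianSpan hX S).sub_starProjection_mem_orthogonal _ _
      ((gaussianSpan hX S).starProjection_apply_mem _)
  have h3 := hS.integral_mul (sigmaOf_le hm S) (sigmaOf_le hm S₁) (sigmaOf_le hm S₂)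
    ((hX.memLp t).inner_const x) (stronglyMeasurable_inner_sigmaOf ht x)
    ((hX.memLp t').inner_const x') (stronglyMeasurable_inner_sigmaOf ht' x')
  have hce (t : 𝕋) (x : U) : P[fun ω => ⟪X t ω, x⟫_ℝ | sigmaOf X S] =ᵐ[P] Q (coord hX t x) :=
    (condExp_congr_ae (coeFn_coord hX t x).symm).trans
      (condExp_eq_starProjection hX hg hm h0 (coord_mem_gaussianSpan hX (mem_univ t) x))
  have h4 : ⟪coord hX t x, coord hX t' x'⟫_ℝ = ⟪Q (coord hX t x), Q (coord hX t' x')⟫_ℝ := by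
    rw [inner_eq_integral_mul, inner_eq_integral_mul]
    refine ((integral_congr_ae ?_).trans h3).trans (integral_congr_ae ?_)
    · filter_upwards [coeFn_coord hX t x, coeFn_coord hX t' x'] with ω h h'
      rw [h, h']
    · filter_upwards [hce t x, hce t' x'] with ω h h'
      rw [h, h']
  rw [inner_sub_right] at h1
  rw [inner_sub_left] at h2
  rw [inner_sub_left, inner_sub_right, inner_sub_right]
  linarith

end GaussianHilbertSpace

/-! ### Topology and Lebesgue measure of the time set -/

section TimeSet

variable {𝕋 : Set ℝ}

theorem IsTimeSet.isClosed (h : IsTimeSet 𝕋) : IsClosed 𝕋 := by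
  rcases h with rfl | ⟨T, -, rfl⟩ | rfl
  exacts [isClosed_Ici, isClosed_Icc, isClosed_univ]

theorem IsTimeSet.ordConnected (h : IsTimeSet 𝕋) : 𝕋.OrdConnected := by
  rcases h with rfl | ⟨T, -, rfl⟩ | rfl
  exacts [ordConnected_Ici, ordConnected_Icc, ordConnected_univ]

theorem IsTimeSet.subset_closure_interior (h : IsTimeSet 𝕋) : 𝕋 ⊆ closure (interior 𝕋) := by
  rcases h with rfl | ⟨T, hT, rfl⟩ | rfl
  · rw [interior_Ici, closure_Ioi]
  · rw [interior_Icc, closure_Ioo hT.ne]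
  · simp

theorem IsTimeSet.isFiniteMeasureOnCompacts (h : IsTimeSet 𝕋) :
    IsFiniteMeasureOnCompacts (lebesgue 𝕋) where
  lt_top_of_isCompact K hK := by
    rw [comap_subtype_coe_apply h.isClosed.measurableSet]
    exact (hK.image continuous_subtype_val).measure_lt_top

theorem IsTimeSet.isOpenPosMeasure (h : IsTimeSet 𝕋) : (lebesgue 𝕋).IsOpenPosMeasure where
  open_pos V hV hne := by
    rw [comap_subtype_coe_apply h.isClosed.measurableSet]
    obtain ⟨O, hO, rfl⟩ := isOpen_induced_iff.1 hV
    obtain ⟨t, ht⟩ := hne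
    have h1 : (O ∩ interior 𝕋).Nonempty :=
      mem_closure_iff.1 (h.subset_closure_interior t.2) O hO ht
    refine ((hO.inter isOpen_interior).measure_pos volume h1).ne' ∘ fun h0 =>
      measure_mono_null (fun x hx => ?_) h0
    exact ⟨⟨x, interior_subset hx.2⟩, hx.1, rfl⟩

end TimeSet

/-! ### Test functions and the fundamental lemma of the calculus of variations -/

section TestFunction

variable {𝕋 : Set ℝ} {U : Type*} [NormedAddCommGroup U] [InnerProductSpace ℝ U]

theorem IsSmooth.continuous {φ : 𝕋 → U} (h : IsSmooth φ) : Continuous φ := by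
  obtain ⟨g, hg, hφ⟩ := h
  have : φ = 𝕋.domRestrict g := funext hφ
  rw [this]
  exact hg.continuousOn.domRestrict

theorem IsTestFunction.memLp {J : Set 𝕋} {F : Set U} {φ : 𝕋 → U} (h : IsTestFunction J F φ)
    (h𝕋 : IsTimeSet 𝕋) : MemLp φ 2 (lebesgue 𝕋) := by
  have := h𝕋.isFiniteMeasureOnCompacts
  exact h.smooth.continuous.memLp_of_hasCompactSupport h.hasCompactSupport

theorem IsTestFunction.mono {J J' : Set 𝕋} {F F' : Set U} {φ : 𝕋 → U} (h : IsTestFunction J F φ)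
    (hJ : J ⊆ J') (hF : F ⊆ F') : IsTestFunction J' F' φ :=
  ⟨h.smooth, h.hasCompactSupport, h.tsupport_subset.trans hJ, fun t => hF (h.mem t)⟩

variable (𝕋 U) in
/-- The vector space `C_c^∞(𝕋; U)`. -/
def testSubmodule : Submodule ℝ (𝕋 → U) where
  carrier := {φ | IsTestFunction univ univ φ}
  zero_mem' := ⟨⟨0, contDiffOn_const, fun _ => rfl⟩, HasCompactSupport.zero, subset_univ _,
    fun _ => mem_univ _⟩
  add_mem' := by
    rintro φ ψ ⟨⟨g, hg, hφ⟩, hc, -, -⟩ ⟨⟨g', hg', hψ⟩, hc', -, -⟩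
    exact ⟨⟨g + g', hg.add hg', fun t => by simp [hφ, hψ]⟩, hc.add hc', subset_univ _,
      fun _ => mem_univ _⟩
  smul_mem' := by
    rintro c φ ⟨⟨g, hg, hφ⟩, hc, -, -⟩
    exact ⟨⟨c • g, hg.const_smul c, fun t => by simp [hφ]⟩,
      hc.mono (Function.support_const_smul_subset c φ), subset_univ _, fun _ => mem_univ _⟩

theorem isTestFunction_coe (φ : testSubmodule 𝕋 U) :
    IsTestFunction (univ : Set 𝕋) univ φ.1 := φ.2

/-- The inclusion of `C_c^∞(𝕋; U)` into `L²(𝕋; U)`. -/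
def testToL2 (h𝕋 : IsTimeSet 𝕋) : testSubmodule 𝕋 U →ₗ[ℝ] L2 𝕋 U where
  toFun φ := ((isTestFunction_coe φ).memLp h𝕋).toLp φ.1
  map_add' φ ψ := MemLp.toLp_add ((isTestFunction_coe φ).memLp h𝕋) ((isTestFunction_coe ψ).memLp h𝕋)
  map_smul' c φ := MemLp.toLp_const_smul c ((isTestFunction_coe φ).memLp h𝕋)

theorem coeFn_testToL2 (h𝕋 : IsTimeSet 𝕋) (φ : testSubmodule 𝕋 U) :
    testToL2 h𝕋 φ =ᵐ[lebesgue 𝕋] φ.1 :=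
  ((isTestFunction_coe φ).memLp h𝕋).coeFn_toLp

theorem isTestFunction_bump (h𝕋 : IsTimeSet 𝕋) {t₀ : ℝ} (ρ : ContDiffBump t₀) (x : U) :
    IsTestFunction (univ : Set 𝕋) univ fun t : 𝕋 => ρ t • x := by
  refine ⟨⟨fun t => ρ t • x, (ρ.contDiff.smul contDiff_const).contDiffOn, fun _ => rfl⟩, ?_,
    subset_univ _, fun _ => mem_univ _⟩
  have h := ρ.hasCompactSupport.comp_isClosedEmbedding h𝕋.isClosed.isClosedEmbedding_subtypeVal
  exact h.smul_right (f' := fun _ => x)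

/-- A continuous function on `𝕋` whose integral against every bump function vanishes is zero. -/
theorem eq_zero_of_forall_integral_bump (h𝕋 : IsTimeSet 𝕋) {h : 𝕋 → ℝ} (hc : Continuous h)
    (h0 : ∀ (t₀ : ℝ) (ρ : ContDiffBump t₀), ∫ t : 𝕋, ρ t * h t ∂(lebesgue 𝕋) = 0) : h = 0 := by
  have := h𝕋.isFiniteMeasureOnCompacts
  have := h𝕋.isOpenPosMeasure
  -- A one-sided bound suffices, applied to `h` and to `-h`. If `k t > 0`, a bump supported in a
  -- ball where `k` is positive has a positive integral against `k`.
  have key : ∀ k : 𝕋 → ℝ, Continuous k →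
      (∀ (t₀ : ℝ) (ρ : ContDiffBump t₀), ∫ t : 𝕋, ρ t * k t ∂(lebesgue 𝕋) = 0) →
      ∀ t, k t ≤ 0 := by
    intro k hk hk0 t
    by_contra! ht
    obtain ⟨r, hr, hball⟩ := Metric.isOpen_iff.1 (isOpen_lt continuous_const hk) t ht
    let ρ : ContDiffBump (t : ℝ) := ⟨r / 2, r, half_pos hr, half_lt_self hr⟩
    have hρ : HasCompactSupport fun s : 𝕋 => ρ s :=
      ρ.hasCompactSupport.comp_isClosedEmbedding h𝕋.isClosed.isClosedEmbedding_subtypeVal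
    refine (Continuous.integral_pos_of_hasCompactSupport_nonneg_nonzero (μ := lebesgue 𝕋)
      (f := fun s : 𝕋 => ρ s * k s) (x := t) ?_ hρ.mul_right ?_ ?_).ne' (hk0 t ρ)
    · exact (ρ.continuous.comp continuous_subtype_val).mul hk
    · intro s
      by_cases hs : dist (s : ℝ) t < r
      · exact mul_nonneg ρ.nonneg (le_of_lt (hball hs))
      · simp [ρ.zero_of_le_dist (x := (s : ℝ)) (not_lt.1 hs)]
    · have : ρ (t : ℝ) = 1 := ρ.one_of_mem_closedBall (Metric.mem_closedBall_self (half_pos hr).le)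
      simp [this, ht.ne']
  funext t
  refine le_antisymm (key h hc h0 t) ?_
  have := key (fun t => -h t) hc.neg (fun t₀ ρ => by simp [integral_neg, h0 t₀ ρ]) t
  simpa using this

end TestFunction

/-! ### The pairing of the process with test functions -/

section Pairing

variable {𝕋 : Set ℝ} {U : Type*} [NormedAddCommGroup U] [InnerProductSpace ℝ U]
  {Ω : Type*} {mΩ : MeasurableSpace Ω} {P : Measure Ω} {X : 𝕋 → Ω → U}

/-- Exhibits `coord` as a continuous bilinear expression in `x` and `X t`, from which its linearity
and its continuity in time follow. -/
theorem coord_eq_compLpL₂ (hX : IsMeanSquareContinuous X P) (t : 𝕋) (x : U) :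
    coord hX t x = (innerSL ℝ).compLpL₂ 2 P x ((hX.memLp t).toLp (X t)) := by
  ext1
  filter_upwards [coeFn_coord hX t x, (hX.memLp t).coeFn_toLp,
    (innerSL ℝ x).coeFn_compLp ((hX.memLp t).toLp (X t))] with ω h1 h2 h3
  rw [h1, ContinuousLinearMap.compLpL₂_apply_apply, h3, h2, innerSL_apply_apply, real_inner_comm]

theorem continuous_coord (hX : IsMeanSquareContinuous X P) {φ : 𝕋 → U} (hφ : Continuous φ) :
    Continuous fun t => coord hX t (φ t) := by
  simp only [coord_eq_compLpL₂]
  exact (((innerSL ℝ).compLpL₂ 2 P).continuous.comp hφ).clm_apply hX.continuous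

theorem integrable_coord (h𝕋 : IsTimeSet 𝕋) (hX : IsMeanSquareContinuous X P) {φ : 𝕋 → U}
    (hφ : Continuous φ) (hc : HasCompactSupport φ) :
    Integrable (fun t => coord hX t (φ t)) (lebesgue 𝕋) := by
  have := h𝕋.isFiniteMeasureOnCompacts
  refine (continuous_coord hX hφ).integrable_of_hasCompactSupport (hc.mono fun t ht h0 => ht ?_)
  simp only [coord_eq_compLpL₂]
  rw [h0, map_zero, zero_apply]

theorem integrable_coord_test (h𝕋 : IsTimeSet 𝕋) (hX : IsMeanSquareContinuous X P)
    (φ : testSubmodule 𝕋 U) : Integrable (fun t => coord hX t (φ.1 t)) (lebesgue 𝕋) :=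
  integrable_coord h𝕋 hX φ.2.smooth.continuous φ.2.hasCompactSupport

/-- The pairing `φ ↦ ⟨X, φ⟩` as a linear map. -/
def pairingₗ (h𝕋 : IsTimeSet 𝕋) (hX : IsMeanSquareContinuous X P) :
    testSubmodule 𝕋 U →ₗ[ℝ] Lp ℝ 2 P where
  toFun φ := pairing hX φ.1
  map_add' φ ψ := by
    refine Eq.trans ?_ (integral_add (integrable_coord_test h𝕋 hX φ)
      (integrable_coord_test h𝕋 hX ψ))
    refine integral_congr_ae (ae_of_all _ fun t => ?_)
    change coord hX t (φ.1 t + ψ.1 t) = coord hX t (φ.1 t) + coord hX t (ψ.1 t)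
    simp only [coord_eq_compLpL₂, map_add, add_apply]
  map_smul' c φ := by
    refine Eq.trans ?_ (integral_smul c _)
    refine integral_congr_ae (ae_of_all _ fun t => ?_)
    change coord hX t (c • φ.1 t) = c • coord hX t (φ.1 t)
    simp only [coord_eq_compLpL₂, map_smul, smul_apply]

theorem inner_pairing (h𝕋 : IsTimeSet 𝕋) (hX : IsMeanSquareContinuous X P)
    (φ : testSubmodule 𝕋 U) (ξ : Lp ℝ 2 P) :
    ⟪ξ, pairing hX φ.1⟫_ℝ = ∫ t, ⟪ξ, coord hX t (φ.1 t)⟫_ℝ ∂(lebesgue 𝕋) :=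
  ((innerSL ℝ ξ).integral_comp_comm (integrable_coord_test h𝕋 hX φ)).symm

theorem coord_smul (hX : IsMeanSquareContinuous X P) (t : 𝕋) (c : ℝ) (x : U) :
    coord hX t (c • x) = c • coord hX t x := by
  simp only [coord_eq_compLpL₂, map_smul, smul_apply]

/-- A random variable whose covariance with every `⟨X, f⟩` is `⟨φ, f⟩` has covariance
`⟪φ(t), x⟫` with every `⟪X(t), x⟫`. -/
theorem inner_coord_eq (h𝕋 : IsTimeSet 𝕋) (hX : IsMeanSquareContinuous X P) {φ : 𝕋 → U}
    (hφ : Continuous φ) {ξ : Lp ℝ 2 P}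
    (h : ∀ f : testSubmodule 𝕋 U,
      ⟪ξ, pairing hX f.1⟫_ℝ = ∫ t, ⟪φ t, f.1 t⟫_ℝ ∂(lebesgue 𝕋)) (t : 𝕋) (x : U) :
    ⟪ξ, coord hX t x⟫_ℝ = ⟪φ t, x⟫_ℝ := by
  have := h𝕋.isFiniteMeasureOnCompacts
  have hc : Continuous fun t => ⟪ξ, coord hX t x⟫_ℝ :=
    continuous_const.inner (continuous_coord hX continuous_const)
  have hc' : Continuous fun t => ⟪φ t, x⟫_ℝ := hφ.inner continuous_const
  rw [← sub_eq_zero]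
  refine congrFun (eq_zero_of_forall_integral_bump h𝕋 (hc.sub hc') fun t₀ ρ => ?_) t
  have hρ : HasCompactSupport fun s : 𝕋 => ρ s :=
    ρ.hasCompactSupport.comp_isClosedEmbedding h𝕋.isClosed.isClosedEmbedding_subtypeVal
  have hρc : Continuous fun s : 𝕋 => ρ s := ρ.continuous.comp continuous_subtype_val
  -- Testing with `ρ · x` turns the hypothesis into equality of the integrals of two continuous
  -- scalar functions against every bump.
  have h1 := h ⟨_, isTestFunction_bump h𝕋 ρ x⟩
  rw [inner_pairing h𝕋] at h1
  simp only [coord_smul, inner_smul_right] at h1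
  simp only [Pi.sub_apply, mul_sub]
  rw [integral_sub, h1, sub_self]
  · exact (hρc.mul hc).integrable_of_hasCompactSupport hρ.mul_right
  · exact (hρc.mul hc').integrable_of_hasCompactSupport hρ.mul_right

end Pairing

/-! ### The isometry induced by the colouring -/

section Coloured

variable {𝕋 : Set ℝ} {U : Type*} [NormedAddCommGroup U] [InnerProductSpace ℝ U] [CompleteSpace U]
  {Ω : Type*} {mΩ : MeasurableSpace Ω} {P : Measure Ω} {X : 𝕋 → Ω → U}
  {Ω' : Type*} {mΩ' : MeasurableSpace Ω'} {P' : Measure Ω'}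
  {B : L2 𝕋 U →L[ℝ] L2 𝕋 U} {W : L2 𝕋 U → Ω' → ℝ}

/-- Equality in law preserves second moments, and the isonormal covariance evaluates the one on the
right. -/
theorem IsColouredBy.norm_pairing {hX : IsMeanSquareContinuous X P}
    (hcol : IsColouredBy hX B W P') (hW : IsIsonormal W P') (h𝕋 : IsTimeSet 𝕋)
    (φ : testSubmodule 𝕋 U) :
    ‖pairing hX φ.1‖ = ‖ContinuousLinearMap.adjoint B (testToL2 h𝕋 φ)‖ := by
  have h := hcol φ.1 φ.2 _ (coeFn_testToL2 h𝕋 φ)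
  have h1 := (h.comp (u := fun x : ℝ => x * x) (by fun_prop)).integral_eq
  have h2 := hW.covariance (ContinuousLinearMap.adjoint B (testToL2 h𝕋 φ))
    (ContinuousLinearMap.adjoint B (testToL2 h𝕋 φ))
  have h3 : ⟪pairing hX φ.1, pairing hX φ.1⟫_ℝ = _ :=
    (inner_eq_integral_mul _ _).trans (h1.trans h2)
  rw [real_inner_self_eq_norm_sq, real_inner_self_eq_norm_sq] at h3
  exact (sq_eq_sq₀ (norm_nonneg _) (norm_nonneg _)).1 h3

theorem IsColouredBy.inner_oneL2_coord [IsProbabilityMeasure P] {hX : IsMeanSquareContinuous X P}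
    (hcol : IsColouredBy hX B W P') (hW : IsIsonormal W P') (h𝕋 : IsTimeSet 𝕋) (t : 𝕋) (x : U) :
    ⟪oneL2 P, coord hX t x⟫_ℝ = 0 := by
  rw [inner_coord_eq h𝕋 hX (φ := fun _ => 0) continuous_const (fun f => ?_), inner_zero_left]
  rw [inner_oneL2, (hcol f.1 f.2 _ (coeFn_testToL2 h𝕋 f)).integral_eq, hW.centered]
  simp

/-- A process coloured by `B`, with `B` injective, induces an isometry `V` of `L²(𝕋; U)` into
`L²(Ω)` such that `⟨X, f⟩ = V (B* f)`. -/
theorem IsColouredBy.exists_isometry {hX : IsMeanSquareContinuous X P}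
    (hcol : IsColouredBy hX B W P') (hW : IsIsonormal W P') (h𝕋 : IsTimeSet 𝕋)
    (hB : Function.Injective B)
    (hd : DenseRange (testToL2 h𝕋 : testSubmodule 𝕋 U →ₗ[ℝ] L2 𝕋 U)) :
    ∃ V : L2 𝕋 U →ₗᵢ[ℝ] Lp ℝ 2 P,
      (∀ f : testSubmodule 𝕋 U,
        V (ContinuousLinearMap.adjoint B (testToL2 h𝕋 f)) = pairing hX f.1) ∧
      ∀ g, V g ∈ gaussianSpan hX univ := by
  let e : testSubmodule 𝕋 U →ₗ[ℝ] L2 𝕋 U :=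
    (ContinuousLinearMap.adjoint B).toLinearMap ∘ₗ testToL2 h𝕋
  -- The orthogonal complement of the range of `B*` is the kernel of `B`, which is trivial.
  have hadj : DenseRange (ContinuousLinearMap.adjoint B) := by
    have h1 : (LinearMap.range (ContinuousLinearMap.adjoint B).toLinearMap).topologicalClosure
        = ⊤ := by
      rw [Submodule.topologicalClosure_eq_top_iff, ContinuousLinearMap.orthogonal_range,
        ContinuousLinearMap.adjoint_adjoint]
      exact LinearMap.ker_eq_bot.2 hB
    intro g
    have h2 : g ∈ (LinearMap.range
        (ContinuousLinearMap.adjoint B).toLinearMap).topologicalClosure := by simp [h1]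
    exact h2
  have he : DenseRange e := hadj.comp hd (ContinuousLinearMap.adjoint B).continuous
  have hnorm : ∀ f, ‖pairingₗ h𝕋 hX f‖ = ‖e f‖ := fun f => hcol.norm_pairing hW h𝕋 f
  let V := (pairingₗ h𝕋 hX).extendOfNorm e
  have hV : ∀ f, V (e f) = pairingₗ h𝕋 hX f :=
    LinearMap.extendOfNorm_eq he ⟨1, fun f => by rw [one_mul, hnorm f]⟩
  refine ⟨⟨V.toLinearMap, fun g => ?_⟩, hV, fun g => ?_⟩
  · refine he.induction_on (p := fun g => ‖V g‖ = ‖g‖) g (isClosed_eq (by fun_prop) (by fun_prop))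
      fun f => ?_
    rw [hV, hnorm]
  · refine he.induction_on (p := fun g => V g ∈ gaussianSpan hX univ) g
      ((Submodule.isClosed_topologicalClosure _).preimage V.continuous) fun f => ?_
    -- By the bipolar identity it suffices to test against `ξ` orthogonal to the whole process; the
    -- inner product then moves inside the time integral.
    rw [hV, ← Submodule.orthogonal_orthogonal (gaussianSpan hX univ)]
    intro ξ hξ
    change ⟪ξ, pairing hX f.1⟫_ℝ = 0
    rw [inner_pairing h𝕋]
    refine (integral_congr_ae (ae_of_all _ fun t => ?_)).trans (integral_zero 𝕋 ℝ)
    rw [real_inner_comm]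
    exact hξ _ (coord_mem_gaussianSpan hX (mem_univ t) _)

end Coloured

/-! ### Splitting test functions and separating supports -/

section Cutting

variable {𝕋 : Set ℝ} {U : Type*} [NormedAddCommGroup U] [InnerProductSpace ℝ U]

/-- Cutting a test function off by the indicator of a set whose frontier does not meet its support
yields a test function. -/
theorem IsTestFunction.indicator {J R : Set 𝕋} {F : Set U} {φ : 𝕋 → U}
    (h : IsTestFunction J F φ) (hF : (0 : U) ∈ F)
    (hR : ∀ t ∈ tsupport φ, R ∈ 𝓝 t ∨ Rᶜ ∈ 𝓝 t) :
    IsTestFunction (J ∩ R) F (R.indicator φ) := by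
  classical
  have hsub : tsupport (R.indicator φ) ⊆ tsupport φ :=
    closure_mono (support_indicator.trans_subset inter_subset_right)
  have hcases : ∀ t, R.indicator φ =ᶠ[𝓝 t] φ ∨ R.indicator φ =ᶠ[𝓝 t] 0 := by
    intro t
    by_cases ht : t ∈ tsupport φ
    · rcases hR t ht with h1 | h1
      · exact .inl (by filter_upwards [h1] with s hs using indicator_of_mem hs φ)
      · exact .inr (by filter_upwards [h1] with s hs using indicator_of_notMem hs φ)
    · right
      filter_upwards [notMem_tsupport_iff_eventuallyEq.1 ht] with s hs
      by_cases hsR : s ∈ R <;> simp [hsR, hs]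
  refine ⟨?_, h.hasCompactSupport.mono' ((subset_tsupport _).trans hsub), fun t ht => ?_,
    fun t => ?_⟩
  · obtain ⟨g, hg, hφ⟩ := h.smooth
    -- Smoothness is only required within `𝕋`, so the value 0 outside is an arbitrary choice.
    refine ⟨fun x => if hx : x ∈ 𝕋 then R.indicator φ ⟨x, hx⟩ else 0, fun x hx => ?_,
      fun t => by simp⟩
    have hext : ∀ {k : ℝ → U} {l : 𝕋 → U}, (∀ t : 𝕋, l t = k t) →
        R.indicator φ =ᶠ[𝓝 ⟨x, hx⟩] l →
        (fun x => if hx : x ∈ 𝕋 then R.indicator φ ⟨x, hx⟩ else 0) =ᶠ[𝓝[𝕋] x] k := by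
      intro k l hkl hev
      rw [nhds_subtype_eq_comap] at hev
      obtain ⟨V, hV, hVs⟩ := hev
      filter_upwards [mem_nhdsWithin_of_mem_nhds hV, self_mem_nhdsWithin] with y hy hy𝕋
      have : R.indicator φ ⟨y, hy𝕋⟩ = l ⟨y, hy𝕋⟩ := hVs hy
      rw [dif_pos hy𝕋, this, hkl]
    rcases hcases ⟨x, hx⟩ with h1 | h1
    · exact (hg x hx).congr_of_eventuallyEq_of_mem (hext hφ h1) hx
    · exact (contDiffWithinAt_const (c := (0 : U))).congr_of_eventuallyEq_of_mem
        (hext (l := 0) (fun _ => rfl) h1) hx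
  · have htφ := hsub ht
    refine ⟨h.tsupport_subset htφ, ?_⟩
    rcases hR t htφ with h1 | h1
    · exact mem_of_mem_nhds h1
    · refine absurd ht (notMem_tsupport_iff_eventuallyEq.2 ?_)
      filter_upwards [h1] with s hs using indicator_of_notMem hs φ
  · by_cases ht : t ∈ R <;> simp [ht, hF, h.mem t]

theorem IsTestFunction.eq_zero {J : Set 𝕋} {F : Set U} {φ : 𝕋 → U}
    (h : IsTestFunction J F φ) {t : 𝕋} (ht : t ∉ J) : φ t = 0 :=
  image_eq_zero_of_notMem_tsupport fun h' => ht (h.tsupport_subset h')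

/-- Locally around a point outside the closure of `J`, either all points are above `J` or none
is. -/
theorem mem_nhds_of_notMem_closure {J : Set 𝕋} {t : 𝕋}
    (ht : t ∉ closure J) :
    {t : 𝕋 | ∀ j ∈ J, j < t} ∈ 𝓝 t ∨ {t : 𝕋 | ∀ j ∈ J, j < t}ᶜ ∈ 𝓝 t := by
  by_cases h : ∀ j ∈ J, j < t
  · left
    obtain ⟨ε, hε, hball⟩ := Metric.mem_nhds_iff.1 (isClosed_closure.isOpen_compl.mem_nhds ht)
    refine Metric.mem_nhds_iff.2 ⟨ε, hε, fun t' ht' j hj => ?_⟩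
    by_contra! hle
    refine hball (a := j) ?_ (subset_closure hj)
    have h1 : (t' : ℝ) ≤ j := hle
    have h2 : (j : ℝ) < t := h j hj
    have h3 : |(t' : ℝ) - t| < ε := ht'
    change |(j : ℝ) - t| < ε
    rw [abs_lt] at h3 ⊢
    constructor <;> linarith
  · right
    push Not at h
    obtain ⟨j, hj, htj⟩ := h
    have hlt : t < j := lt_of_le_of_ne htj fun h => ht (h ▸ subset_closure hj)
    have hopen : IsOpen {s : 𝕋 | (s : ℝ) < j} := isOpen_lt (by fun_prop) continuous_const
    filter_upwards [hopen.mem_nhds hlt] with s hs hs'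
    exact lt_asymm (show s < j from hs) (hs' j hj)

/-- Two ordered disjoint compact sets of times are separated by a gap around some time. -/
theorem exists_gap (h𝕋 : 𝕋.OrdConnected) {K₁ K₂ : Set 𝕋} (h₁ : IsCompact K₁) (h₂ : IsCompact K₂)
    (hne₁ : K₁.Nonempty) (hne₂ : K₂.Nonempty) (h : ∀ a ∈ K₁, ∀ b ∈ K₂, a < b) :
    ∃ s : 𝕋, ∃ r : ℝ, 0 < r ∧ (∀ a ∈ K₁, (a : ℝ) ≤ s - r) ∧ ∀ b ∈ K₂, s + r ≤ (b : ℝ) := by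
  obtain ⟨a, ha, hamax⟩ := h₁.exists_isMaxOn hne₁ (continuous_subtype_val.continuousOn)
  obtain ⟨b, hb, hbmin⟩ := h₂.exists_isMinOn hne₂ (continuous_subtype_val.continuousOn)
  have hab : (a : ℝ) < b := h a ha b hb
  refine ⟨⟨(a + b) / 2, h𝕋.out a.2 b.2 ⟨by linarith, by linarith⟩⟩, (b - a) / 2, by linarith,
    fun a' ha' => ?_, fun b' hb' => ?_⟩
  · have : (a' : ℝ) ≤ a := hamax ha'
    change (a' : ℝ) ≤ (a + b) / 2 - (b - a) / 2
    linarith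
  · have : (b : ℝ) ≤ b' := hbmin hb'
    change (a + b : ℝ) / 2 + (b - a) / 2 ≤ b'
    linarith

end Cutting

/-! ### Orthogonality for ordered supports, then for intervals -/

section Main

variable {𝕋 : Set ℝ} {U : Type*} [NormedAddCommGroup U] [InnerProductSpace ℝ U] [CompleteSpace U]
  [SecondCountableTopology U] [MeasurableSpace U] [BorelSpace U]
  {Ω : Type*} {mΩ : MeasurableSpace Ω} {P : Measure Ω} [IsProbabilityMeasure P] {X : 𝕋 → Ω → U}

/-- If `ξ` and `η` belong to the Gaussian Hilbert space of a weakly Markov Gaussian process, and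
there is a gap `(s - r, s + r)` such that `ξ` is orthogonal to all later and `η` to all earlier
values of the process, both including the gap, then `ξ` and `η` are orthogonal. -/
theorem IsWeakMarkov.inner_eq_zero {hXmeas : ∀ t, StronglyMeasurable (X t)}
    (hMarkov : IsWeakMarkov (Filtration.natural X hXmeas) X P)
    (hX : IsMeanSquareContinuous X P) (hg : IsGaussianProcess X P)
    (h0 : ∀ t x, ⟪oneL2 P, coord hX t x⟫_ℝ = 0) {s : 𝕋} {r : ℝ} (hr : 0 < r) {ξ η : Lp ℝ 2 P}
    (hξ : ξ ∈ gaussianSpan hX univ)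
    (hξ0 : ∀ t : 𝕋, (s - r : ℝ) < t → ∀ x, ⟪coord hX t x, ξ⟫_ℝ = 0)
    (hη0 : ∀ t : 𝕋, (t : ℝ) < s + r → ∀ x, ⟪coord hX t x, η⟫_ℝ = 0) : ⟪ξ, η⟫_ℝ = 0 := by
  obtain ⟨δ, hδ, hδ'⟩ := hMarkov.condIndep s
  have hmin : 0 < min δ r := lt_min hδ hr
  have hε := half_lt_self hmin
  set ε := min δ r / 2 with hεdef
  have hεr : ε < r := hε.trans_le (min_le_right _ _)
  -- `ε` is below `δ`, so the Markov property applies, and below `r`, so the window lies in the gap.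
  -- The natural filtration at `s` unfolds to `sigmaOf X (Iic s)`.
  have hind : CondIndepGiven P (sigmaOf X {u : 𝕋 | (u : ℝ) ∈ Ioo ((s : ℝ) - ε) ((s : ℝ) + ε)})
      (sigmaOf X (Iic s)) (sigmaOf X (Ici s)) :=
    hδ' ε (half_pos hmin) (hε.trans_le (min_le_left _ _))
  have hunion : coordSet hX (Iic s) ∪ coordSet hX (Ici s) = coordSet hX univ := by
    ext ζ
    constructor
    · rintro (⟨t, -, x, h⟩ | ⟨t, -, x, h⟩) <;> exact ⟨t, mem_univ _, x, h⟩
    · rintro ⟨t, -, x, h⟩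
      exact (le_total t s).imp (fun ht => ⟨t, ht, x, h⟩) fun ht => ⟨t, ht, x, h⟩
  refine inner_eq_zero_of_inner_sub_starProjection
    (inner_sub_starProjection_eq_zero hX hg (fun t => (hXmeas t).measurable) h0 hind)
    (by rw [hunion]; exact hξ) ?_ ?_ ?_ ?_
  · exact mem_orthogonal_gaussianSpan hX fun t ht x => hξ0 t (by linarith [ht.1]) x
  · exact mem_orthogonal_gaussianSpan hX fun t ht x => hη0 t (by linarith [ht.2]) x
  · rintro _ ⟨t, ht, x, rfl⟩
    have ht' : (s : ℝ) ≤ t := ht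
    exact hξ0 t (by linarith) x
  · rintro _ ⟨t, ht, x, rfl⟩
    have ht' : (t : ℝ) ≤ s := ht
    exact hη0 t (by linarith) x

variable {Ω' : Type*} {mΩ' : MeasurableSpace Ω'} {P' : Measure Ω'}
  {L : L2 𝕋 U →ₗ.[ℝ] L2 𝕋 U} {B : L2 𝕋 U →L[ℝ] L2 𝕋 U} {W : L2 𝕋 U → Ω' → ℝ}

theorem IsBoundedInverse.injective {H : Type*} [NormedAddCommGroup H] [NormedSpace ℝ H]
    {L : H →ₗ.[ℝ] H} {B : H →L[ℝ] H} (h : IsBoundedInverse L B) : Function.Injective B := by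
  intro f g hfg
  obtain ⟨h1, h2⟩ := h.right_inv f
  obtain ⟨h3, h4⟩ := h.right_inv g
  rw [← h2, ← h4]
  congr 2

/-- The precision operator of a weakly Markov Gaussian process does not couple test functions
whose supports are ordered and disjoint. -/
theorem inner_eq_zero_of_tsupport_lt (h𝕋 : IsTimeSet 𝕋) (hB : IsBoundedInverse L B)
    (hW : IsIsonormal W P') {hXmeas : ∀ t, StronglyMeasurable (X t)}
    (hg : IsGaussianProcess X P) {hX : IsMeanSquareContinuous X P} (hcol : IsColouredBy hX B W P')
    (hd : DenseRange (testToL2 h𝕋 : testSubmodule 𝕋 U →ₗ[ℝ] L2 𝕋 U))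
    (hMarkov : IsWeakMarkov (Filtration.natural X hXmeas) X P)
    {φ ψ : L.domain} {φ' ψ' : 𝕋 → U} (hφ : IsTestFunction univ univ φ')
    (hψ : IsTestFunction univ univ ψ') (hφφ' : (φ : L2 𝕋 U) =ᵐ[lebesgue 𝕋] φ')
    (hψψ' : (ψ : L2 𝕋 U) =ᵐ[lebesgue 𝕋] ψ')
    (hlt : ∀ a ∈ tsupport φ', ∀ b ∈ tsupport ψ', a < b) : ⟪L φ, L ψ⟫_ℝ = 0 := by
  have hzero : ∀ {χ : L.domain} {χ' : 𝕋 → U}, (χ : L2 𝕋 U) =ᵐ[lebesgue 𝕋] χ' →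
      ¬ (tsupport χ').Nonempty → L χ = 0 := by
    intro χ χ' hχ hne
    have h1 : χ' = 0 := tsupport_eq_empty_iff.1 (not_nonempty_iff_eq_empty.1 hne)
    have h2 : χ = 0 := by
      ext1
      refine Lp.ext (hχ.trans ?_)
      rw [h1]
      exact (Lp.coeFn_zero _ _ _).symm
    rw [h2, L.map_zero]
  by_cases hne₁ : (tsupport φ').Nonempty
  swap
  · rw [hzero hφφ' hne₁, inner_zero_left]
  by_cases hne₂ : (tsupport ψ').Nonempty
  swap
  · rw [hzero hψψ' hne₂, inner_zero_right]
  obtain ⟨V, hV, hVmem⟩ := hcol.exists_isometry hW h𝕋 hB.injective hd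
  -- `V (L χ)` is dual to the process: `⟨V(Lχ), V(B* f)⟩ = ⟨B L χ, f⟩ = ⟨χ, f⟩`.
  have hcoord : ∀ {χ : L.domain} {χ' : 𝕋 → U}, IsTestFunction univ univ χ' →
      (χ : L2 𝕋 U) =ᵐ[lebesgue 𝕋] χ' → ∀ t x, ⟪V (L χ), coord hX t x⟫_ℝ = ⟪χ' t, x⟫_ℝ := by
    intro χ χ' hχ' hχ
    refine inner_coord_eq h𝕋 hX hχ'.smooth.continuous fun f => ?_
    rw [← hV f, V.inner_map_map, ContinuousLinearMap.adjoint_inner_right, hB.left_inv, L2.inner_def]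
    refine integral_congr_ae ?_
    filter_upwards [hχ, coeFn_testToL2 h𝕋 f] with t h1 h2
    rw [h1, h2]
  obtain ⟨s, r, hr, h₁, h₂⟩ := exists_gap h𝕋.ordConnected hφ.hasCompactSupport
    hψ.hasCompactSupport hne₁ hne₂ hlt
  rw [← V.inner_map_map]
  refine hMarkov.inner_eq_zero hX hg (hcol.inner_oneL2_coord hW h𝕋) (s := s) hr (hVmem _)
    (fun t ht x => ?_) (fun t ht x => ?_)
  · rw [real_inner_comm, hcoord hφ hφφ', image_eq_zero_of_notMem_tsupport (f := φ'),
      inner_zero_left]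
    exact fun h => by linarith [h₁ t h]
  · rw [real_inner_comm, hcoord hψ hψψ', image_eq_zero_of_notMem_tsupport (f := ψ'),
      inner_zero_left]
    exact fun h => by linarith [h₂ t h]

end Main

end WeakMarkov

end

theorem mainTheorem1
    {U : Type*} [NormedAddCommGroup U] [InnerProductSpace ℝ U] [CompleteSpace U]
    [SecondCountableTopology U] [MeasurableSpace U] [BorelSpace U]
    {Ω : Type*} [MeasurableSpace Ω] (P : Measure Ω) [IsProbabilityMeasure P]
    {Ω' : Type*} [MeasurableSpace Ω'] (P' : Measure Ω') [IsProbabilityMeasure P']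
    (𝕋 : Set ℝ) (h𝕋 : WeakMarkov.IsTimeSet 𝕋)
    (L : WeakMarkov.L2 𝕋 U →ₗ.[ℝ] WeakMarkov.L2 𝕋 U)
    (Linv : WeakMarkov.L2 𝕋 U →L[ℝ] WeakMarkov.L2 𝕋 U)
    (hLinv : WeakMarkov.IsBoundedInverse L Linv)
    (W : WeakMarkov.L2 𝕋 U → Ω' → ℝ) (hW : WeakMarkov.IsIsonormal W P')
    (X : 𝕋 → Ω → U) (hXmeas : ∀ t, StronglyMeasurable (X t))
    (hXgauss : IsGaussianProcess X P)
    (hXcont : WeakMarkov.IsMeanSquareContinuous X P)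
    (hXcol : WeakMarkov.IsColouredBy hXcont Linv W P')
    (F : Set U) (hF : Dense F)
    (hdom : WeakMarkov.testSet (univ : Set 𝕋) F ⊆ (L.domain : Set (WeakMarkov.L2 𝕋 U)))
    (hdense : Dense (WeakMarkov.testSet (univ : Set 𝕋) F))
    (himage : Dense (L '' {f : L.domain | (f : WeakMarkov.L2 𝕋 U) ∈
      WeakMarkov.testSet (univ : Set 𝕋) F}))
    (hMarkov : WeakMarkov.IsWeakMarkov (Filtration.natural X hXmeas) X P) :
    ∀ J : Set 𝕋, IsOpen J → J.OrdConnected →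
      ∀ (φ : WeakMarkov.L2 𝕋 U) (hφ : φ ∈ WeakMarkov.testSet J F)
        (ψ : WeakMarkov.L2 𝕋 U) (hψ : ψ ∈ WeakMarkov.testSet (closure J)ᶜ F),
        ⟪L ⟨φ, hdom (WeakMarkov.testSet_subset_univ J F hφ)⟩,
          L ⟨ψ, hdom (WeakMarkov.testSet_subset_univ (closure J)ᶜ F hψ)⟩⟫_ℝ = 0 := by
  intro J _ hJ φ hφ ψ hψ
  have hd : DenseRange (WeakMarkov.testToL2 h𝕋 :
      WeakMarkov.testSubmodule 𝕋 U →ₗ[ℝ] WeakMarkov.L2 𝕋 U) := by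
    refine hdense.mono ?_
    rintro f ⟨f', hf', hff'⟩
    exact ⟨⟨f', hf'.mono (subset_univ _) (subset_univ _)⟩,
      Lp.ext ((WeakMarkov.coeFn_testToL2 h𝕋 _).trans hff'.symm)⟩
  obtain ⟨φ', hφ', hφφ'⟩ := id hφ
  obtain ⟨ψ', hψ', hψψ'⟩ := id hψ
  have key : ∀ {φ ψ : L.domain} {φ' ψ' : 𝕋 → U} {J₁ J₂ : Set 𝕋} {F₁ F₂ : Set U},
      WeakMarkov.IsTestFunction J₁ F₁ φ' → WeakMarkov.IsTestFunction J₂ F₂ ψ' →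
      (φ : WeakMarkov.L2 𝕋 U) =ᵐ[WeakMarkov.lebesgue 𝕋] φ' →
      (ψ : WeakMarkov.L2 𝕋 U) =ᵐ[WeakMarkov.lebesgue 𝕋] ψ' →
      (∀ a ∈ J₁, ∀ b ∈ J₂, a < b) → ⟪L φ, L ψ⟫_ℝ = 0 := fun h₁ h₂ h₃ h₄ hlt =>
    WeakMarkov.inner_eq_zero_of_tsupport_lt h𝕋 hLinv hW hXgauss hXcol hd hMarkov
      (h₁.mono (subset_univ _) (subset_univ _)) (h₂.mono (subset_univ _) (subset_univ _)) h₃ h₄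
      fun a ha b hb => hlt a (h₁.tsupport_subset ha) b (h₂.tsupport_subset hb)
  rcases J.eq_empty_or_nonempty with rfl | ⟨j₀, hj₀⟩
  · exact key hφ' hψ' hφφ' hψψ' fun a ha => ha.elim
  -- `F` is only a set; cutting off stays within it because `ψ'` itself takes the value 0 on the
  -- nonempty `J`.
  have hF0 : (0 : U) ∈ F := by
    rw [← hψ'.eq_zero (t := j₀) fun h => h (subset_closure hj₀)]
    exact hψ'.mem j₀
  set R : Set 𝕋 := {t : 𝕋 | ∀ j ∈ J, j < t} with hR
  have hloc : ∀ t ∈ tsupport ψ', R ∈ 𝓝 t ∨ Rᶜ ∈ 𝓝 t := fun t ht =>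
    WeakMarkov.mem_nhds_of_notMem_closure (hψ'.tsupport_subset ht)
  have hr := hψ'.indicator hF0 hloc
  have hl := hψ'.indicator (R := Rᶜ) hF0 fun t ht => by
    rw [compl_compl]
    exact (hloc t ht).symm
  have hr2 := (hr.memLp h𝕋).coeFn_toLp
  have hl2 := (hl.memLp h𝕋).coeFn_toLp
  have hmem : ∀ {J' : Set 𝕋} {χ : 𝕋 → U} (h : WeakMarkov.IsTestFunction J' F χ),
      (h.memLp h𝕋).toLp χ ∈ L.domain := fun h =>
    hdom (WeakMarkov.testSet_subset_univ _ F ⟨_, h, (h.memLp h𝕋).coeFn_toLp⟩)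
  have hsum : (⟨ψ, hdom (WeakMarkov.testSet_subset_univ (closure J)ᶜ F hψ)⟩ : L.domain)
      = ⟨_, hmem hr⟩ + ⟨_, hmem hl⟩ := by
    ext1
    refine Lp.ext (hψψ'.trans ?_)
    filter_upwards [hr2, hl2, Lp.coeFn_add ((hr.memLp h𝕋).toLp _) ((hl.memLp h𝕋).toLp _)]
      with t h1 h2 h3
    refine Eq.trans ?_ h3.symm
    rw [Pi.add_apply, h1, h2, indicator_self_add_compl_apply]
  rw [hsum, L.map_add, inner_add_right, key hφ' hr hφφ' hr2 fun a ha b hb => hb.2 a ha, zero_add,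
    real_inner_comm]
  refine key hl hφ' hl2 hφφ' fun b hb a ha => ?_
  -- A point outside `J` that is not above all of `J` is below all of it: otherwise it would lie
  -- between two points of the order-connected set `J`.
  have hbJ : b ∉ J := fun h => hb.1 (subset_closure h)
  have hbR := hb.2
  simp only [hR, mem_compl_iff, mem_ofPred_eq] at hbR
  push Not at hbR
  obtain ⟨j, hj, hbj⟩ := hbR
  by_contra! hab
  exact hbJ (hJ.out ha hj ⟨hab, hbj⟩)
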